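/- **Conventions.** A representation of a set $X$ is a surjective partial map $\delta_X:\subseteq\mathbb N^{\mathbb N}\to X$; a represented space is a set with a representation. A partial multi-valued function $f:\subseteq X\rightrightarrows Y$ assigns to each $x\in X$ a set $f(x)\subseteq Y$, with $\operatorname{dom}(f)=\{x: f(x)\neq\emptyset\}$; composition is $(g\circ f)(x)=\{z:(\exists y\in f(x))\,z\in g(y)\}$ with $\operatorname{dom}(g\circ f)=\{x\in\operatorname{dom}(f): f(x)\subseteq\operatorname{dom}(g)\}$. A partial $F:\subseteq\mathbb N^{\mathbb N}\to\mathbb N^{\mathbb N}$ realizes $f$, written $F\vdash f$, if $\delta_YF(p)\in f(\delta_X(p))$ whenever $\delta_X(p)\in\operatorname{dom}(f)$; $f$ is computable if it has a computable realizer. We write $f\le_{\mathrm W}g$ if there are computable $K,H:\subseteq\mathbb N^{\mathbb N}\to\mathbb N^{\mathbb N}$ such that $H\langle \mathrm{id},GK\rangle\vdash f$ for all $G\vdash g$. A computable metric space is a metric space $(Y,d)$ with a dense sequence $\alpha:\mathbb N\to Y$ such that $(i,j)\mapsto d(\alpha(i),\alpha(j))$ is a computable double sequence of reals; it is represented by its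 Cauchy representation, in which $p$ is a name of $y$ iff $d(y,\alpha(p(i)))<2^{-i}$ for all $i$. Let $\mathrm{Tr}$ be the set of binary trees $T\subseteq\{0,1\}^*$ (sets of words closed under prefixes), represented by characteristic functions, let $[T]\subseteq 2^{\mathbb N}$ be the set of infinite paths of $T$, and let $\mu$ be the uniform measure on $2^{\mathbb N}$. The problem $\frac12\text{-}\mathsf{WWKL}:\subseteq\mathrm{Tr}\rightrightarrows2^{\mathbb N}$ is $T\mapsto[T]$ with domain $\{T:\mu([T])>\frac12\}$. The jump of a representation $\delta$ is $\delta'=\delta\circ\lim$, where $\lim\langle p_0,p_1,\dots\rangle=\lim_{n\to\infty}p_n$ in $\mathbb N^{\mathbb N}$; the $n$-fold jump $h^{(n)}$ of a problem $h$ is $h$ with its input representation replaced by its $n$-fold jump. **Theorem.** Let $X$ be a represented space, $Y$ a computable metric space, and $f:\subseteq X\to Y$ a single-valued (possibly partial, in particular possibly total) function. 1. If $f\le_{\mathrm W}\frac12\text{-}\mathsf{WWKL}\circ g$ for some represented space $Z$ and some (not necessarily computable) multi-valued function $g:\subseteq Z\rightrightarrows\mathrm{Tr}$, then $f$ is computable.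 2. If $f\le_{\mathrm W}(\frac12\text{-}\mathsf{WWKL})^{(n)}$ for some $n\in\mathbb N$, then $f$ is computable. -/

import Mathlib

open Filter Topology MeasureTheory

namespace Weihrauch

/-- Baire space. -/
abbrev Baire : Type := ℕ → ℕ

/-- The finite word consisting of the first `n` values of a sequence. -/
def initSeg {A : Type*} (p : ℕ → A) (n : ℕ) : List A := (List.range n).map p

/-- A partial function `F` on Baire space is computable if a computable monotone function on finite
words approximates it: `h w` is the output that a machine with one-way output tape has written when
it has seen the part `w` of its input. On each `p` in the domain of `F` the outputs `h (p↾n)` are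
prefixes of `F p` of unbounded length. Nothing is required outside the domain of `F`, i.e.
restrictions of computable functions count as computable. -/
def ComputableOnBaire (F : Baire →. Baire) : Prop :=
  ∃ h : List ℕ → List ℕ, Computable h ∧ (∀ u v : List ℕ, u <+: v → h u <+: h v) ∧
    ∀ p q : Baire, q ∈ F p →
      (∀ n, h (initSeg p n) = initSeg q (h (initSeg p n)).length) ∧
      ∀ k, ∃ n, k ≤ (h (initSeg p n)).length

/-- A representation of `X`: a surjective partial map from Baire space to `X`, given by its graph
(`IsName p x` says that the map is defined at `p` with value `x`). -/
structure SetRepresentation (X : Type*) where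
  IsName : Baire → X → Prop
  unique : ∀ p x y, IsName p x → IsName p y → x = y
  exists_name : ∀ x, ∃ p, IsName p x

/-- Partial multi-valued functions from `X` to `Y`, given by their sets of possible values. -/
abbrev MultiFun (X Y : Type*) : Type _ := X → Set Y

namespace MultiFun

/-- The domain consists of the points with at least one possible value. -/
def dom {X Y : Type*} (f : MultiFun X Y) : Set X := {x | (f x).Nonempty}

/-- The composition `g ∘ f`, with domain `{x ∈ dom f | f x ⊆ dom g}`. -/
def comp {X Y Z : Type*} (g : MultiFun Y Z) (f : MultiFun X Y) : MultiFun X Z :=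
  fun x => {z | f x ⊆ g.dom ∧ ∃ y ∈ f x, z ∈ g y}

/-- A partial single-valued function as a multi-valued function. -/
def ofPFun {X Y : Type*} (f : X →. Y) : MultiFun X Y := fun x => {y | y ∈ f x}

end MultiFun

/-- `F` is a realizer of `f` with respect to the given representations. -/
def Realizes {X Y : Type*} (δX : SetRepresentation X) (δY : SetRepresentation Y)
    (F : Baire →. Baire) (f : MultiFun X Y) : Prop :=
  ∀ p x, δX.IsName p x → x ∈ f.dom → ∃ q ∈ F p, ∃ y ∈ f x, δY.IsName q y

/-- A (multi-valued) function between represented spaces is computable if it has a computable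
realizer. -/
def IsComputable {X Y : Type*} (δX : SetRepresentation X) (δY : SetRepresentation Y)
    (f : MultiFun X Y) : Prop :=
  ∃ F : Baire →. Baire, ComputableOnBaire F ∧ Realizes δX δY F f

/-- The pairing `⟨p, q⟩` on Baire space: `p` on the even and `q` on the odd positions. -/
def pairBaire (p q : Baire) : Baire := fun n => if n % 2 = 0 then p (n / 2) else q (n / 2)

/-- The partial function `H⟨id, GK⟩`. -/
def reductionComp (H G K : Baire →. Baire) : Baire →. Baire :=
  fun p => (K p).bind fun r => (G r).bind fun q => H (pairBaire p q)

/-- Weihrauch reducibility `f ≤_W g`. -/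
def Reducible {X Y Z W : Type*} (δX : SetRepresentation X) (δY : SetRepresentation Y)
    (δZ : SetRepresentation Z) (δW : SetRepresentation W) (f : MultiFun X Y) (g : MultiFun Z W) : Prop :=
  ∃ K H : Baire →. Baire, ComputableOnBaire K ∧ ComputableOnBaire H ∧
    ∀ G : Baire →. Baire, Realizes δZ δW G g → Realizes δX δY (reductionComp H G K) f

/-- `q` is the limit in Baire space of the sequence `(p_i)` coded by `p⟨i, j⟩ = p_i j`. -/
def IsLim (p q : Baire) : Prop :=
  Tendsto (fun i : ℕ => (fun j : ℕ => p (Nat.pair i j) : Baire)) atTop (𝓝 q)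

/-- The jump `δ ∘ lim` of a representation `δ`. -/
def SetRepresentation.jump {X : Type*} (δ : SetRepresentation X) : SetRepresentation X where
  IsName p x := ∃ q, IsLim p q ∧ δ.IsName q x
  unique := by
    rintro p x y ⟨q, hq, hx⟩ ⟨r, hr, hy⟩
    obtain rfl := tendsto_nhds_unique hq hr
    exact δ.unique q x y hx hy
  exists_name x := by
    obtain ⟨q, hq⟩ := δ.exists_name x
    exact ⟨fun n => q n.unpair.2, q, by simp [IsLim], hq⟩

/-- The `n`-fold jump of a representation. The `n`-fold jump of a multi-valued function is the same
multi-valued function, with the input representation replaced by its `n`-fold jump. -/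
def SetRepresentation.iterJump {X : Type*} (δ : SetRepresentation X) : ℕ → SetRepresentation X
  | 0 => δ
  | n + 1 => (δ.iterJump n).jump

/-- The structure of a computable metric space: a dense sequence `α` such that the distances
`dist (α i) (α j)` form a computable double sequence of real numbers. -/
structure ComputableMetric (Y : Type*) [MetricSpace Y] where
  α : ℕ → Y
  dense : DenseRange α
  computable_dist : ∃ a b : ℕ × ℕ × ℕ → ℕ, Computable a ∧ Computable b ∧
    ∀ i j k, |dist (α i) (α j) - (a (i, j, k) : ℝ) / ((b (i, j, k) : ℝ) + 1)| ≤ (1 / 2 : ℝ) ^ k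

/-- The Cauchy representation: `p` is a name of `y` if `d(y, α(p i)) < 2⁻ⁱ` for all `i`. -/
def ComputableMetric.cauchy {Y : Type*} [MetricSpace Y] (M : ComputableMetric Y) :
    SetRepresentation Y where
  IsName p y := ∀ i, dist y (M.α (p i)) < (1 / 2 : ℝ) ^ i
  unique p x y hx hy := by
    have h0 : Tendsto (fun i : ℕ => (1 / 2 : ℝ) ^ i) atTop (𝓝 0) :=
      tendsto_pow_atTop_nhds_zero_of_lt_one (by norm_num) (by norm_num)
    have key : ∀ z, (∀ i, dist z (M.α (p i)) < (1 / 2 : ℝ) ^ i) →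
        Tendsto (fun i => M.α (p i)) atTop (𝓝 z) := fun z hz => by
      rw [tendsto_iff_dist_tendsto_zero]
      exact squeeze_zero (fun _ => dist_nonneg)
        (fun i => by rw [dist_comm]; exact (hz i).le) h0
    exact tendsto_nhds_unique (key x hx) (key y hy)
  exists_name y := by
    choose p hp using fun i : ℕ => M.dense.exists_dist_lt y (ε := (1 / 2 : ℝ) ^ i) (by positivity)
    exact ⟨p, hp⟩

/-- Cantor space. -/
abbrev Cantor : Type := ℕ → Bool

/-- Cantor space is represented by the inclusion into Baire space. -/
def cantorRep : SetRepresentation Cantor where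
  IsName p q := ∀ n, p n = (q n).toNat
  unique p x y hx hy := by
    funext n
    have h := (hx n).symm.trans (hy n)
    revert h
    cases x n <;> cases y n <;> simp
  exists_name q := ⟨fun n => (q n).toNat, fun _ => rfl⟩

/-- The uniform measure on Cantor space: the infinite product of the uniform measures on
`{0, 1}`. -/
noncomputable def cantorMeasure : Measure Cantor :=
  Measure.infinitePi fun _ : ℕ => (PMF.uniformOfFintype Bool).toMeasure

/-- Binary trees: sets of finite binary words that are closed under prefixes. -/
def Tr : Type := {T : Set (List Bool) // ∀ u v : List Bool, u <+: v → v ∈ T → u ∈ T}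

open Classical in
/-- Binary trees are represented by their characteristic functions. -/
noncomputable def treeRep : SetRepresentation Tr where
  IsName p T := ∀ n, p n = if ∃ w ∈ T.1, Encodable.encode w = n then 1 else 0
  unique p S T hS hT := by
    have key : ∀ R : Tr, (∀ n, p n = if ∃ w ∈ R.1, Encodable.encode w = n then 1 else 0) →
        ∀ w, w ∈ R.1 ↔ p (Encodable.encode w) = 1 := by
      intro R hR w
      rw [hR]
      simp
    exact Subtype.ext (Set.ext fun w => (key S hS w).trans (key T hT w).symm)
  exists_name T := ⟨_, fun _ => rfl⟩

/-- The set `[T]` of infinite paths of a binary tree. -/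
def paths (T : Tr) : Set Cantor := {q | ∀ n, initSeg q n ∈ T.1}

/-- The problem `ε-WWKL`: given a binary tree `T` with `μ([T]) > ε`, find an infinite path. It is a
restriction of `WWKL`, so for negative `ε` the condition is `μ([T]) > 0`. -/
noncomputable def quantWWKL (ε : ℝ) : MultiFun Tr Cantor :=
  fun T => {q | ENNReal.ofReal ε < cantorMeasure (paths T) ∧ q ∈ paths T}

end Weihrauch

open Weihrauch

namespace Weihrauch

/-! ### Computable functions on Baire space from decidable tests -/

/-! Let `p` be a name of `x`. Since realizers may choose their answers freely, `H⟨p, q⟩` is a name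
of the one point `f x` for every solution `q` of the instance named by `K p`, and these solutions
have measure above `1/2`. Hence the instance itself need not be known: one runs `H⟨p, q⟩` for all
`q` in parallel and accepts a point as an approximation of `f x` once more than half of the words of
some length vote for it. An accepted point is correct because two sets of measure above `1/2`
intersect. Some point is accepted because, by continuity from below, finitely many input values
suffice on more than half of all `q`. `exists_computableOnBaire_of_test` turns the vote into a
computable function, `exists_computableOnBaire_majority` carries out the vote, and
`isComputable_of_reducible_of_half_lt` extracts it from a reduction. How instances are represented
or produced plays no role, which covers both `g` and the jumps. -/

theorem initSeg_length {A : Type*} (p : ℕ → A) (n : ℕ) : (initSeg p n).length = n := by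
  simp [initSeg]

theorem initSeg_take {A : Type*} (p : ℕ → A) {m n : ℕ} (h : m ≤ n) :
    (initSeg p n).take m = initSeg p m := by
  rw [initSeg, initSeg, ← List.map_take, List.take_range, min_eq_left h]

theorem initSeg_prefix {A : Type*} (p : ℕ → A) {m n : ℕ} (h : m ≤ n) :
    initSeg p m <+: initSeg p n := by
  rw [← initSeg_take p h]
  exact List.take_prefix _ _

theorem getElem?_initSeg {A : Type*} (p : ℕ → A) {k n : ℕ} (h : k < n) :
    (initSeg p n)[k]? = some (p k) := by
  simp [initSeg, h]

/-- The output after `m` steps of the machine that, in step `m`, appends the candidate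
`(Nat.unpair m).1` if the test `t` accepts it as the next output on the first `m` input values. -/
def testedOutput (t : List ℕ → ℕ → ℕ → Bool) (w : List ℕ) : ℕ → List ℕ
  | 0 => []
  | m + 1 =>
    bif t (w.take m) (testedOutput t w m).length m.unpair.1 then
      testedOutput t w m ++ [m.unpair.1] else testedOutput t w m

theorem testedOutput_prefix_succ (t : List ℕ → ℕ → ℕ → Bool) (w : List ℕ) (m : ℕ) :
    testedOutput t w m <+: testedOutput t w (m + 1) := by
  rw [testedOutput]
  cases t (w.take m) (testedOutput t w m).length m.unpair.1
  · exact List.prefix_rfl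
  · exact List.prefix_append _ _

theorem testedOutput_prefix (t : List ℕ → ℕ → ℕ → Bool) (w : List ℕ) {m n : ℕ} (h : m ≤ n) :
    testedOutput t w m <+: testedOutput t w n := by
  induction n, h using Nat.le_induction with
  | base => exact List.prefix_rfl
  | succ n _ ih => exact ih.trans (testedOutput_prefix_succ t w n)

/-- The first `m` steps read at most the first `m` input values; this yields the monotonicity
demanded by `ComputableOnBaire`. -/
theorem testedOutput_congr (t : List ℕ → ℕ → ℕ → Bool) {u v : List ℕ} (h : u <+: v) {m : ℕ}
    (hm : m ≤ u.length) : testedOutput t u m = testedOutput t v m := by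
  induction m with
  | zero => rfl
  | succ m ih =>
    have hm' : m ≤ u.length := (Nat.le_succ m).trans hm
    have htake : u.take m = v.take m := by
      obtain ⟨s, rfl⟩ := h
      rw [List.take_append_of_le_length hm']
    rw [testedOutput, testedOutput, ih hm', htake]

theorem testedOutput_length_mono (t : List ℕ → ℕ → ℕ → Bool) {u v : List ℕ} (h : u <+: v) :
    testedOutput t u u.length <+: testedOutput t v v.length := by
  rw [testedOutput_congr t h le_rfl]
  exact testedOutput_prefix t v h.length_le

theorem computable_testedOutput {t : List ℕ → ℕ → ℕ → Bool}
    (ht : Computable fun x : List ℕ × ℕ × ℕ => t x.1 x.2.1 x.2.2) :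
    Computable fun w : List ℕ => testedOutput t w w.length := by
  have hm : Computable fun x : List ℕ × ℕ × List ℕ => x.2.1 := Computable.fst.comp .snd
  have hacc : Computable fun x : List ℕ × ℕ × List ℕ => x.2.2 := Computable.snd.comp .snd
  have hc : Computable fun x : List ℕ × ℕ × List ℕ => x.2.1.unpair.1 :=
    Computable.fst.comp (Computable.unpair.comp hm)
  have htake : Computable fun x : List ℕ × ℕ × List ℕ => x.1.take x.2.1 :=
    (Primrec.list_take.to_comp).comp hm .fst
  have hstep : Computable₂ fun (w : List ℕ) (x : ℕ × List ℕ) =>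
      bif t (w.take x.1) x.2.length x.1.unpair.1 then x.2 ++ [x.1.unpair.1] else x.2 :=
    Computable.cond
      (ht.comp (Computable.pair htake (Computable.pair (Computable.list_length.comp hacc) hc)))
      (Computable.list_concat.comp hacc hc) hacc
  refine (Computable.nat_rec Computable.list_length (Computable.const []) hstep).of_eq fun w => ?_
  generalize w.length = n
  induction n with
  | zero => rfl
  | succ n ih => simp only [testedOutput, ← ih]

/-- The entry at position `k` was appended when the output had length `k`, so the test that admitted
it was a test for position `k`. -/
theorem testedOutput_accepted (t : List ℕ → ℕ → ℕ → Bool) (p : Baire) {n k c : ℕ}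
    (h : (testedOutput t (initSeg p n) n)[k]? = some c) : ∃ m, t (initSeg p m) k c = true := by
  suffices H : ∀ m ≤ n, (testedOutput t (initSeg p n) m)[k]? = some c →
      ∃ m, t (initSeg p m) k c = true from H n le_rfl h
  intro m
  induction m with
  | zero => intro _ h; simp [testedOutput] at h
  | succ m ih =>
    intro hm h
    rw [testedOutput, initSeg_take p ((Nat.le_succ m).trans hm)] at h
    cases ht : t (initSeg p m) (testedOutput t (initSeg p n) m).length m.unpair.1 with
    | false => exact ih (by omega) (by simpa [ht] using h)
    | true =>
      rw [ht, cond_true] at h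
      rcases lt_trichotomy k (testedOutput t (initSeg p n) m).length with hk | hk | hk
      · rw [List.getElem?_append_left hk] at h
        exact ih (by omega) h
      · subst hk
        simp only [List.getElem?_concat_length, Option.some.injEq] at h
        exact ⟨m, h ▸ ht⟩
      · rw [List.getElem?_eq_none (by simpa using hk)] at h
        cases h

theorem testedOutput_unbounded (t : List ℕ → ℕ → ℕ → Bool) (p : Baire)
    (h : ∀ k, ∃ c, ∀ᶠ n in atTop, t (initSeg p n) k c = true) (k : ℕ) :
    ∃ n, k ≤ (testedOutput t (initSeg p n) n).length := by
  have hmono : ∀ {m n : ℕ}, m ≤ n →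
      testedOutput t (initSeg p m) m <+: testedOutput t (initSeg p n) n := fun {m n} hmn => by
    simpa only [initSeg_length] using testedOutput_length_mono t (initSeg_prefix p hmn)
  induction k with
  | zero => exact ⟨0, Nat.zero_le _⟩
  | succ k ih =>
    obtain ⟨n₀, hn₀⟩ := ih
    obtain ⟨c, hc⟩ := h k
    obtain ⟨n₁, hn₁⟩ := eventually_atTop.1 hc
    -- Every candidate is tried at infinitely many stages; this one tries `c`, and is late enough
    -- because `Nat.pair c i ≥ i`.
    set m := Nat.pair c (max n₀ n₁) with hm
    have hle : max n₀ n₁ ≤ m := Nat.right_le_pair _ _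
    have hlen : k ≤ (testedOutput t (initSeg p m) m).length :=
      hn₀.trans (hmono ((le_max_left _ _).trans hle)).length_le
    refine ⟨m + 1, ?_⟩
    rcases hlen.lt_or_eq with hlt | heq
    · exact Nat.succ_le_of_lt (hlt.trans_le (hmono (Nat.le_succ m)).length_le)
    · have hstep : testedOutput t (initSeg p (m + 1)) m = testedOutput t (initSeg p m) m :=
        (testedOutput_congr t (initSeg_prefix p (Nat.le_succ m))
          (by rw [initSeg_length])).symm
      rw [testedOutput, hstep, initSeg_take p (Nat.le_succ m), ← heq]
      have hunpair : m.unpair.1 = c := by rw [hm, Nat.unpair_pair]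
      rw [hunpair, hn₁ m ((le_max_right _ _).trans hle), cond_true, List.length_append, ← heq]
      simp

/-- A decidable test yields a computable partial function that produces accepted outputs on every
input on which, for every position, some output is accepted at all sufficiently large stages. -/
theorem exists_computableOnBaire_of_test {t : List ℕ → ℕ → ℕ → Bool}
    (ht : Computable fun x : List ℕ × ℕ × ℕ => t x.1 x.2.1 x.2.2) :
    ∃ F : Baire →. Baire, ComputableOnBaire F ∧
      ∀ p, (∀ k, ∃ c, ∀ᶠ n in atTop, t (initSeg p n) k c = true) →
        ∃ q ∈ F p, ∀ k, ∃ n, t (initSeg p n) k (q k) = true := by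
  set h : List ℕ → List ℕ := fun w => testedOutput t w w.length with hh
  have hmono : ∀ u v : List ℕ, u <+: v → h u <+: h v := fun u v => testedOutput_length_mono t
  let Q : Baire → Baire → Prop := fun p q =>
    (∀ n, h (initSeg p n) = initSeg q (h (initSeg p n)).length) ∧
      ∀ k, ∃ n, k ≤ (h (initSeg p n)).length
  -- The domain consists of the inputs with unbounded output; there `Q p` determines `q`, so the
  -- choice is harmless.
  refine ⟨fun p => ⟨∃ q, Q p q, fun hq => hq.choose⟩,
    ⟨h, computable_testedOutput ht, hmono, ?_⟩, fun p hp => ?_⟩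
  · rintro p q ⟨hq, rfl⟩
    exact hq.choose_spec
  · have hseg : ∀ n, h (initSeg p n) = testedOutput t (initSeg p n) n := fun n => by
      rw [hh]; simp only [initSeg_length]
    have hunb : ∀ k, ∃ n, k ≤ (h (initSeg p n)).length := fun k => by
      simpa only [hseg] using testedOutput_unbounded t p hp k
    have hQ : ∃ q, Q p q := by
      choose N hN using fun k => hunb (k + 1)
      refine ⟨fun k => (h (initSeg p (N k)))[k]'(hN k), fun n => ?_, hunb⟩
      refine List.ext_getElem (by rw [initSeg_length]) fun k hk _ => ?_
      simp only [initSeg, List.getElem_map, List.getElem_range]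
      change (h (initSeg p n))[k] = (h (initSeg p (N k)))[k]'(hN k)
      rcases le_total n (N k) with hle | hle
      · exact (hmono _ _ (initSeg_prefix p hle)).getElem hk
      · exact ((hmono _ _ (initSeg_prefix p hle)).getElem (hN k)).symm
    refine ⟨hQ.choose, ⟨hQ, rfl⟩, fun k => ?_⟩
    obtain ⟨hq, hlen⟩ := hQ.choose_spec
    obtain ⟨n, hn⟩ := hlen (k + 1)
    refine testedOutput_accepted t p (n := n) ?_
    rw [← hseg, hq n, getElem?_initSeg _ hn]

theorem computable_add_snd {t : List ℕ → ℕ → ℕ → Bool}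
    (ht : Computable fun x : List ℕ × ℕ × ℕ => t x.1 x.2.1 x.2.2) (d : ℕ) :
    Computable fun x : List ℕ × ℕ × ℕ => t x.1 (x.2.1 + d) x.2.2 := by
  have hadd : Computable fun x : List ℕ × ℕ × ℕ => x.2.1 + d :=
    Primrec.nat_add.to_comp.comp (Computable.fst.comp .snd) (Computable.const d)
  have hpair : Computable fun x : List ℕ × ℕ × ℕ => (x.1, x.2.1 + d, x.2.2) :=
    Computable.pair .fst (Computable.pair hadd (Computable.snd.comp .snd))
  exact ht.comp hpair

theorem computable_card_filter_range {α : Type*} [Primcodable α] {t : α → ℕ → Bool} {f : α → ℕ}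
    (ht : Computable₂ t) (hf : Computable f) :
    Computable fun a => ((Finset.range (f a)).filter fun j => t a j = true).card := by
  have hstep : Computable₂ fun (a : α) (x : ℕ × ℕ) => bif t a x.1 then x.2 + 1 else x.2 :=
    have hacc : Computable fun x : α × ℕ × ℕ => x.2.2 := Computable.snd.comp .snd
    Computable.cond (ht.comp Computable.fst (Computable.fst.comp .snd))
      (Computable.succ.comp hacc) hacc
  refine (Computable.nat_rec hf (Computable.const 0) hstep).of_eq fun a => ?_
  generalize f a = n
  induction n with
  | zero => rfl
  | succ n ih =>
    rw [Finset.range_add_one, Finset.filter_insert]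
    cases h : t a n <;> simp [ih, h]

/-! ### Codes of binary words and the uniform measure -/

/-- The number with binary digits `q 0, …, q (n - 1)`, the least significant first. -/
def cantorCode (n : ℕ) (q : Cantor) : ℕ := Nat.ofBits fun i : Fin n => q i

theorem cantorCode_lt (n : ℕ) (q : Cantor) : cantorCode n q < 2 ^ n := Nat.ofBits_lt_two_pow _

theorem testBit_cantorCode {n i : ℕ} (h : i < n) (q : Cantor) :
    (cantorCode n q).testBit i = q i := by
  simp [cantorCode, h]

/-- Fibres are cylinders, so the product formula for the measure applies to them. -/
theorem cantorCode_fiber {n j : ℕ} (hj : j < 2 ^ n) :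
    {q | cantorCode n q = j} = Set.pi (Finset.range n : Set ℕ) fun i => {j.testBit i} := by
  ext q
  simp only [Set.mem_ofPred_eq, Set.mem_pi, Finset.coe_range, Set.mem_Iio, Set.mem_singleton_iff]
  constructor
  · rintro rfl i hi
    exact (testBit_cantorCode hi q).symm
  · intro h
    refine Nat.eq_of_testBit_eq fun i => ?_
    rcases lt_or_ge i n with hi | hi
    · rw [testBit_cantorCode hi, h i hi]
    · have hpow : 2 ^ n ≤ 2 ^ i := Nat.pow_le_pow_right (by norm_num) hi
      rw [Nat.testBit_lt_two_pow ((cantorCode_lt n q).trans_le hpow),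
        Nat.testBit_lt_two_pow (hj.trans_le hpow)]

theorem measurable_cantorCode (n : ℕ) : Measurable (cantorCode n) := by
  refine measurable_to_countable' fun j => ?_
  rcases lt_or_ge j (2 ^ n) with hj | hj
  · change MeasurableSet {q | cantorCode n q = j}
    rw [cantorCode_fiber hj]
    exact MeasurableSet.pi (Finset.countable_toSet _) fun i _ => measurableSet_singleton _
  · convert MeasurableSet.empty
    ext q
    simpa using ((cantorCode_lt n q).trans_le hj).ne

instance : IsProbabilityMeasure cantorMeasure := by
  unfold cantorMeasure
  infer_instance

theorem cantorMeasure_cantorCode_eq {n j : ℕ} (hj : j < 2 ^ n) :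
    cantorMeasure {q | cantorCode n q = j} = (2 ^ n : ENNReal)⁻¹ := by
  rw [cantorCode_fiber hj, cantorMeasure,
    Measure.infinitePi_pi _ fun i _ => measurableSet_singleton _]
  simp [ENNReal.inv_pow]

theorem cantorMeasure_cantorCode_mem {n : ℕ} {s : Finset ℕ} (hs : s ⊆ Finset.range (2 ^ n)) :
    cantorMeasure {q | cantorCode n q ∈ s} = s.card * (2 ^ n : ENNReal)⁻¹ := by
  have hset : {q | cantorCode n q ∈ s} = ⋃ j ∈ s, {q | cantorCode n q = j} := by
    ext q
    simp
  rw [hset, measure_biUnion_finset]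
  · rw [Finset.sum_congr rfl fun j hj =>
      cantorMeasure_cantorCode_eq (Finset.mem_range.1 (hs hj)), Finset.sum_const, nsmul_eq_mul]
  · intro i _ j _ hij
    exact Set.disjoint_left.2 fun q (hi : cantorCode n q = i) (hj : cantorCode n q = j) =>
      hij (hi.symm.trans hj)
  · exact fun j _ => measurable_cantorCode n (measurableSet_singleton j)

/-- Makes "measure above `1/2`" a decidable comparison of natural numbers. -/
theorem half_lt_cantorMeasure_cantorCode_mem_iff {n : ℕ} {s : Finset ℕ}
    (hs : s ⊆ Finset.range (2 ^ n)) :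
    2⁻¹ < cantorMeasure {q | cantorCode n q ∈ s} ↔ 2 ^ n < 2 * s.card := by
  rw [cantorMeasure_cantorCode_mem hs, ← div_eq_mul_inv,
    ENNReal.lt_div_iff_mul_lt (by simp) (by simp), mul_comm, ← div_eq_mul_inv,
    ENNReal.div_lt_iff (by simp) (by simp), mul_comm]
  exact_mod_cast Iff.rfl

/-! ### Majority vote -/

/-- The interleaving of a word with the binary digits of the number `j`. -/
def interleave (u : List ℕ) (j : ℕ) : List ℕ :=
  (List.range (2 * u.length)).map fun i =>
    if i % 2 = 0 then u.getD (i / 2) 0 else j / 2 ^ (i / 2) % 2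

/-- Ensures that applying `h` to an interleaved word gives a genuine partial output on `⟨p, q⟩`. -/
theorem interleave_initSeg (p : Baire) (q : Cantor) (n : ℕ) :
    interleave (initSeg p n) (cantorCode n q) =
      initSeg (pairBaire p fun i => (q i).toNat) (2 * n) := by
  rw [interleave, initSeg_length]
  refine List.map_inj_left.2 ?_
  intro i hi
  have hi2 : i / 2 < n := by
    have := List.mem_range.1 hi
    omega
  simp only [pairBaire]
  split_ifs
  · rw [List.getD_eq_getElem?_getD, getElem?_initSeg p hi2, Option.getD_some]
  · rw [← Nat.toNat_testBit, testBit_cantorCode hi2]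

theorem primrec_pow : Primrec₂ ((· ^ ·) : ℕ → ℕ → ℕ) :=
  Primrec₂.unpaired'.1 Nat.Primrec.pow

theorem primrec_interleave : Primrec₂ interleave := by
  have hi : Primrec fun x : (List ℕ × ℕ) × ℕ => x.2 := Primrec.snd
  have hhalf : Primrec fun x : (List ℕ × ℕ) × ℕ => x.2 / 2 :=
    Primrec.nat_div.comp hi (Primrec.const 2)
  refine Primrec.list_map
    (Primrec.list_range.comp (Primrec.nat_mul.comp (Primrec.const 2)
      (Primrec.list_length.comp Primrec.fst))) (Primrec.ite ?_ ?_ ?_)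
  · exact Primrec.eq.comp (Primrec.nat_mod.comp hi (Primrec.const 2)) (Primrec.const 0)
  · exact (Primrec.list_getD 0).comp (Primrec.fst.comp Primrec.fst) hhalf
  · exact Primrec.nat_mod.comp (Primrec.nat_div.comp (Primrec.snd.comp Primrec.fst)
      (primrec_pow.comp (Primrec.const 2) hhalf)) (Primrec.const 2)

/-- On the input word `u` and the binary word coded by `j`, the function `h` has produced an output
at position `k` whose distance from `c`, approximated up to `2⁻ᵏ` by `a / (b + 1)`, appears to be at
most `3 * 2⁻ᵏ`. -/
def closeOutput (h : List ℕ → List ℕ) (a b : ℕ × ℕ × ℕ → ℕ) (u : List ℕ) (k c j : ℕ) : Bool :=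
  Option.casesOn (h (interleave u j))[k]? false fun e =>
    decide (a (c, e, k) * 2 ^ k ≤ 3 * (b (c, e, k) + 1))

theorem closeOutput_eq_true_iff {h : List ℕ → List ℕ} {a b : ℕ × ℕ × ℕ → ℕ} {u : List ℕ}
    {k c j : ℕ} : closeOutput h a b u k c j = true ↔
      ∃ e, (h (interleave u j))[k]? = some e ∧ a (c, e, k) * 2 ^ k ≤ 3 * (b (c, e, k) + 1) := by
  rw [closeOutput]
  cases (h (interleave u j))[k]? <;> simp

theorem computable_closeOutput {h : List ℕ → List ℕ} {a b : ℕ × ℕ × ℕ → ℕ} (hh : Computable h)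
    (ha : Computable a) (hb : Computable b) :
    Computable₂ fun (x : List ℕ × ℕ × ℕ) (j : ℕ) => closeOutput h a b x.1 x.2.1 x.2.2 j := by
  have hk : Computable fun x : (List ℕ × ℕ × ℕ) × ℕ => x.1.2.1 :=
    Computable.fst.comp (Computable.snd.comp .fst)
  have hc : Computable fun x : (List ℕ × ℕ × ℕ) × ℕ => x.1.2.2 :=
    Computable.snd.comp (Computable.snd.comp .fst)
  have hk' : Computable fun x : ((List ℕ × ℕ × ℕ) × ℕ) × ℕ => x.1.1.2.1 := hk.comp .fst
  have hcek : Computable fun x : ((List ℕ × ℕ × ℕ) × ℕ) × ℕ => (x.1.1.2.2, x.2, x.1.1.2.1) :=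
    Computable.pair (hc.comp .fst) (Computable.pair .snd hk')
  refine Computable.option_casesOn
    (Computable.list_getElem?.comp
      (hh.comp (primrec_interleave.to_comp.comp (Computable.fst.comp .fst) .snd)) hk)
    (Computable.const false) ?_
  refine (PrimrecRel.decide Primrec.nat_le).to_comp.comp
    (Primrec.nat_mul.to_comp.comp (ha.comp hcek)
      (primrec_pow.to_comp.comp (Computable.const 2) hk'))
    (Primrec.nat_mul.to_comp.comp (Computable.const 3) (Computable.succ.comp (hb.comp hcek)))

/-- More than half of the binary words of the length of `u` produce an output that is close to
`c`. -/
def majorityClose (h : List ℕ → List ℕ) (a b : ℕ × ℕ × ℕ → ℕ) (u : List ℕ) (k c : ℕ) : Bool :=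
  decide (2 ^ u.length <
    2 * ((Finset.range (2 ^ u.length)).filter fun j => closeOutput h a b u k c j = true).card)

theorem computable_majorityClose {h : List ℕ → List ℕ} {a b : ℕ × ℕ × ℕ → ℕ} (hh : Computable h)
    (ha : Computable a) (hb : Computable b) :
    Computable fun x : List ℕ × ℕ × ℕ => majorityClose h a b x.1 x.2.1 x.2.2 := by
  have hpow : Computable fun x : List ℕ × ℕ × ℕ => 2 ^ x.1.length :=
    primrec_pow.to_comp.comp (Computable.const 2) (Computable.list_length.comp .fst)
  exact (PrimrecRel.decide Primrec.nat_lt).to_comp.comp hpow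
    (Primrec.nat_mul.to_comp.comp (Computable.const 2)
      (computable_card_filter_range (computable_closeOutput hh ha hb) hpow))

theorem majorityClose_initSeg_iff {h : List ℕ → List ℕ} {a b : ℕ × ℕ × ℕ → ℕ} {p : Baire}
    {n k c : ℕ} : majorityClose h a b (initSeg p n) k c = true ↔
      2⁻¹ < cantorMeasure {q | closeOutput h a b (initSeg p n) k c (cantorCode n q) = true} := by
  rw [majorityClose, decide_eq_true_iff, initSeg_length,
    ← half_lt_cantorMeasure_cantorCode_mem_iff (Finset.filter_subset _ _)]
  simp [cantorCode_lt]

theorem mul_two_pow_le_iff {m n k : ℕ} :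
    m * 2 ^ k ≤ 3 * (n + 1) ↔ (m : ℝ) / ((n : ℝ) + 1) ≤ 3 * (1 / 2 : ℝ) ^ k := by
  rw [div_le_iff₀ (by positivity), one_div, inv_pow, mul_right_comm, ← div_eq_mul_inv,
    le_div_iff₀ (by positivity)]
  exact_mod_cast Iff.rfl

/-- If `H` is computable, then so is the function that maps `p` to a name of the point `y` such that
`H⟨p, q⟩` is a name of `y` for all `q` in a set of measure greater than `1/2`. -/
theorem exists_computableOnBaire_majority {Y : Type*} [MetricSpace Y] (M : ComputableMetric Y)
    {H : Baire →. Baire} (hH : ComputableOnBaire H) :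
    ∃ F : Baire →. Baire, ComputableOnBaire F ∧ ∀ (p : Baire) (y : Y) (A : Set Cantor),
      2⁻¹ < cantorMeasure A →
      (∀ q ∈ A, ∃ r ∈ H (pairBaire p fun i => (q i).toNat), M.cauchy.IsName r y) →
      ∃ r ∈ F p, M.cauchy.IsName r y := by
  obtain ⟨h, hcomp, hmono, hspec⟩ := hH
  obtain ⟨a, b, ha, hb, hab⟩ := M.computable_dist
  obtain ⟨F, hF, hFspec⟩ := exists_computableOnBaire_of_test
    -- A vote at level `k` only guarantees distance below `5 * 2⁻ᵏ`; the shift by `3` suffices since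
    -- `5 / 8 < 1`.
    (t := fun u k c => majorityClose h a b u (k + 3) c)
    (computable_add_snd (computable_majorityClose hcomp ha hb) 3)
  refine ⟨F, hF, fun p y A hA hAy => ?_⟩
  choose! r hrH hry using hAy
  have hout : ∀ q ∈ A, ∀ n k e, (h (interleave (initSeg p n) (cantorCode n q)))[k]? = some e →
      e = r q k := fun q hq n k e he => by
    rw [interleave_initSeg, (hspec _ _ (hrH q hq)).1] at he
    have hk : k < (h (initSeg (pairBaire p fun i => (q i).toNat) (2 * n))).length := by
      by_contra hk
      rw [List.getElem?_eq_none (by rw [initSeg_length]; exact not_lt.1 hk)] at he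
      cases he
    rw [getElem?_initSeg _ hk] at he
    exact (Option.some.inj he).symm
  have hcast : ∀ c e k, a (c, e, k) * 2 ^ k ≤ 3 * (b (c, e, k) + 1) ↔
      (a (c, e, k) : ℝ) / ((b (c, e, k) : ℝ) + 1) ≤ 3 * (1 / 2 : ℝ) ^ k :=
    fun _ _ _ => mul_two_pow_le_iff
  -- The `5` is `1` for the name `r q`, `1` for the approximated distance and `3` for the test.
  have hsound : ∀ n k c, majorityClose h a b (initSeg p n) k c = true →
      dist y (M.α c) < 5 * (1 / 2 : ℝ) ^ k := fun n k c hc => by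
    rw [majorityClose_initSeg_iff] at hc
    -- `A` is arbitrary; measurability of the voting set alone suffices for the intersection
    -- argument.
    have hmeas : MeasurableSet
        {q | closeOutput h a b (initSeg p n) k c (cantorCode n q) = true} :=
      measurable_cantorCode n (Set.to_countable {j |
        closeOutput h a b (initSeg p n) k c j = true}).measurableSet
    obtain ⟨q, hqA, hq⟩ := nonempty_inter_of_measure_lt_add cantorMeasure hmeas
      (Set.subset_univ A) (Set.subset_univ _) (by
        rw [measure_univ, ← ENNReal.inv_two_add_inv_two]
        exact ENNReal.add_lt_add hA hc)
    obtain ⟨e, he, hle⟩ := closeOutput_eq_true_iff.1 hq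
    obtain rfl := hout q hqA n k e he
    have h1 := hry q hqA k
    have h2 := abs_le.1 (hab c (r q k) k)
    have h3 := (hcast c (r q k) k).1 hle
    have h4 := dist_triangle_right y (M.α c) (M.α (r q k))
    linarith [h2.2]
  have hcomplete : ∀ k, ∃ c, ∀ᶠ n in atTop, majorityClose h a b (initSeg p n) k c = true := by
    intro k
    obtain ⟨q₀, hq₀⟩ : A.Nonempty := nonempty_of_measure_ne_zero (zero_le.trans_lt hA).ne'
    -- `B n` collects the `q ∈ A` whose output at position `k` appears within `n` values of `p` and
    -- of `q`.
    let B : ℕ → Set Cantor := fun n =>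
      {q ∈ A | k < (h (initSeg (pairBaire p fun i => (q i).toNat) (2 * n))).length}
    have hB : Monotone B := fun m n hmn q hq =>
      ⟨hq.1, hq.2.trans_le (hmono _ _ (initSeg_prefix _ (by omega))).length_le⟩
    have hBA : A = ⋃ n, B n := by
      ext q
      refine ⟨fun hq => ?_, fun hq => ?_⟩
      · obtain ⟨n, hn⟩ := (hspec _ _ (hrH q hq)).2 (k + 1)
        exact Set.mem_iUnion.2 ⟨n, hq,
          hn.trans (hmono _ _ (initSeg_prefix _ (by omega))).length_le⟩
      · obtain ⟨n, hn⟩ := Set.mem_iUnion.1 hq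
        exact hn.1
    rw [hBA, hB.measure_iUnion] at hA
    obtain ⟨n₀, hn₀⟩ := lt_iSup_iff.1 hA
    -- Any `q₀ ∈ A` supplies a candidate: two names of `y` differ by less than `2 * 2⁻ᵏ` at position
    -- `k`, and the distance approximation adds `2⁻ᵏ`, whence the `3` in the test.
    refine ⟨r q₀ k, eventually_atTop.2 ⟨n₀, fun n hn => ?_⟩⟩
    refine majorityClose_initSeg_iff.2 (hn₀.trans_le (measure_mono fun q hq => ?_))
    obtain ⟨hqA, hqk⟩ := hB hn hq
    refine closeOutput_eq_true_iff.2 ⟨r q k, ?_, (hcast _ _ _).2 ?_⟩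
    · rw [interleave_initSeg, (hspec _ _ (hrH q hqA)).1, getElem?_initSeg _ hqk]
    · have h1 := hry q hqA k
      have h2 := hry q₀ hq₀ k
      have h3 := abs_le.1 (hab (r q₀ k) (r q k) k)
      have h4 := dist_triangle_left (M.α (r q₀ k)) (M.α (r q k)) y
      linarith [h3.1]
  obtain ⟨q, hqF, hq⟩ := hFspec p fun k => hcomplete (k + 3)
  refine ⟨q, hqF, fun k => ?_⟩
  obtain ⟨n, hn⟩ := hq k
  have h1 := hsound n (k + 3) (q k) hn
  have h2 : (0 : ℝ) < (1 / 2 : ℝ) ^ k := by positivity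
  rw [pow_add] at h1
  norm_num only at h1 h2 ⊢
  linarith

/-! ### From reductions to the majority vote -/

/-- A single-valued function that is reducible to a problem whose sets of solutions have measure
greater than `1/2` is computable. -/
theorem isComputable_of_reducible_of_half_lt {X Y Z : Type*} (δX : SetRepresentation X)
    [MetricSpace Y] (M : ComputableMetric Y) (f : X →. Y) (δZ : SetRepresentation Z)
    (P : MultiFun Z Cantor) (hP : ∀ z ∈ P.dom, 2⁻¹ < cantorMeasure (P z))
    (hred : Reducible δX M.cauchy δZ cantorRep (MultiFun.ofPFun f) P) :
    IsComputable δX M.cauchy (MultiFun.ofPFun f) := by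
  classical
  obtain ⟨K, H, -, hH, hKH⟩ := hred
  obtain ⟨F, hF, hmaj⟩ := exists_computableOnBaire_majority M hH
  refine ⟨F, hF, fun p x hpx hx => ?_⟩
  obtain ⟨y, hy⟩ := id hx
  -- The realizer that is undefined exactly on the names of points outside the domain of `P`.
  let G : Baire →. Baire := fun s =>
    ⟨∃ t z w, δZ.IsName s z ∧ w ∈ P z ∧ cantorRep.IsName t w, fun ht => ht.choose⟩
  have hG : Realizes δZ cantorRep G P := by
    rintro s z hsz ⟨w, hw⟩
    obtain ⟨t, ht⟩ := cantorRep.exists_name w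
    have hdom : (G s).Dom := ⟨t, z, w, hsz, hw, ht⟩
    obtain ⟨z', w', hz', hw', ht'⟩ := hdom.choose_spec
    obtain rfl := δZ.unique s _ _ hz' hsz
    exact ⟨hdom.choose, ⟨hdom, rfl⟩, w', hw', ht'⟩
  -- As `G` is undefined elsewhere, success of the reduction forces `K p` to name a point of
  -- `P.dom`.
  obtain ⟨s, hs, z, hsz, hz⟩ : ∃ s ∈ K p, ∃ z, δZ.IsName s z ∧ z ∈ P.dom := by
    obtain ⟨q, hq, -⟩ := hKH G hG p x hpx hx
    obtain ⟨s, hs, hq⟩ := Part.mem_bind_iff.1 hq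
    obtain ⟨t, ⟨⟨_, z, w, hsz, hw, _⟩, -⟩, -⟩ := Part.mem_bind_iff.1 hq
    exact ⟨s, hs, z, hsz, w, hw⟩
  obtain ⟨r, hrF, hr⟩ := hmaj p y (P z) (hP z hz) fun q hq => by
    -- Changing `G` only at `s` to answer `q` leaves a realizer, so `H⟨p, q⟩` must also name `y`.
    have hG' : Realizes δZ cantorRep
        (fun s' => if s' = s then Part.some fun i => (q i).toNat else G s') P := by
      intro s' z' hsz' hz'
      by_cases hss : s' = s
      · subst hss
        obtain rfl := δZ.unique s' _ _ hsz hsz'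
        exact ⟨fun i => (q i).toNat, by simp, q, hq, fun _ => rfl⟩
      · simpa only [if_neg hss] using hG s' z' hsz' hz'
    obtain ⟨r, hr, y', hy', hry'⟩ := hKH _ hG' p x hpx hx
    obtain ⟨s', hs', hr⟩ := Part.mem_bind_iff.1 hr
    obtain rfl := Part.mem_unique hs' hs
    simp only [if_true, Part.bind_some] at hr
    exact ⟨r, hr, Part.mem_unique hy' hy ▸ hry'⟩
  exact ⟨r, hrF, y, hy, hr⟩

end Weihrauch

theorem theorem13p2 {X Y : Type*} (δX : SetRepresentation X) [MetricSpace Y]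
    (M : ComputableMetric Y) (f : X →. Y) :
    (∀ {Z : Type*} (δZ : SetRepresentation Z) (g : MultiFun Z Tr),
      Reducible δX M.cauchy δZ cantorRep (MultiFun.ofPFun f)
          (MultiFun.comp (quantWWKL (1 / 2)) g) →
        IsComputable δX M.cauchy (MultiFun.ofPFun f)) ∧
    (∀ n : ℕ,
      Reducible δX M.cauchy (treeRep.iterJump n) cantorRep (MultiFun.ofPFun f)
          (quantWWKL (1 / 2)) →
        IsComputable δX M.cauchy (MultiFun.ofPFun f)) := by
  have hhalf : ENNReal.ofReal (1 / 2) = 2⁻¹ := by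
    rw [one_div, ENNReal.ofReal_inv_of_pos two_pos, ENNReal.ofReal_ofNat]
  refine ⟨fun {Z} δZ g hred => ?_, fun n hred => ?_⟩
  · refine isComputable_of_reducible_of_half_lt δX M f δZ _ ?_ hred
    rintro z ⟨w, hsub, T, hT, hμ, hw⟩
    -- The paths of a single tree `T ∈ g z` already have measure above `1/2`, and all of them are
    -- solutions.
    refine (hhalf ▸ hμ).trans_le (measure_mono fun q hq => ?_)
    exact ⟨hsub, T, hT, hμ, hq⟩
  · refine isComputable_of_reducible_of_half_lt δX M f _ _ ?_ hred
    rintro T ⟨w, hμ, hw⟩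
    exact (hhalf ▸ hμ).trans_le (measure_mono fun q hq => ⟨hμ, hq⟩)
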